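/- There is a constant $C>0$ such that for every integer $k\ge 2$ and every finite simple graph $G$ on at least $Ck\ln k$ vertices, $G$ or its complement $\overline{G}$ contains an induced subgraph on exactly $k$ vertices with minimum degree at least $\frac12(k-1)$. Equivalently, in terms of the fixed quasi-Ramsey number $R^*_{1/2}(k)$, defined as the least $n$ such that every finite simple graph $G$ on at least $n$ vertices has a set $S$ of exactly $k$ vertices for which the induced subgraph $G[S]$ or $\overline{G}[S]$ has minimum degree at least $\frac12(k-1)$: there is a constant $C>0$ such that $R^*_{1/2}(k)$ exists and $R^*_{1/2}(k)\le Ck\ln k$ for all $k\ge 2$. Both assertions hold with the same constant $C$. -/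

import Mathlib

universe u

open Classical in
/-- `G` has an induced subgraph on exactly `k` vertices with minimum degree at least `d`. -/
def HasInducedMinDegree {V : Type u} (G : SimpleGraph V) (k : ℕ) (d : ℝ) : Prop :=
  ∃ S : Finset V, S.card = k ∧ d ≤ ((G.induce (S : Set V)).minDegree : ℝ)

/-- The natural numbers `n` such that every finite graph `G` on at least `n` vertices, or its
complement, has an induced subgraph on exactly `k` vertices with minimum degree at least
`c * (k - 1)`. -/
def quasiRamseyBounds (c : ℝ) (k : ℕ) : Set ℕ :=
  {n | ∀ (V : Type u) [Fintype V] (G : SimpleGraph V), n ≤ Fintype.card V →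
    HasInducedMinDegree G k (c * ((k : ℝ) - 1)) ∨ HasInducedMinDegree Gᶜ k (c * ((k : ℝ) - 1))}

/-- `R` is the fixed quasi-Ramsey number `R*_c(k)`: the least `n` such that every finite graph on
at least `n` vertices, or its complement, has an induced subgraph on exactly `k` vertices with
minimum degree at least `c * (k - 1)`. In particular, such an `n` exists. -/
def IsFixedQuasiRamseyNumber (c : ℝ) (k R : ℕ) : Prop :=
  IsLeast (quasiRamseyBounds.{u} c k) R

/-! Encode `G` as a symmetric ±1 matrix with zero diagonal. Complementing negates the matrix, and
degree at least (k-1)/2 inside a k-set means a nonnegative row sum there. A k-set must be found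
whose row sums are all nonnegative, for the matrix or its negative.

Take a set maximising the excess |f(S,S)| - 2λ|S|, with λ of order √(k log k). Deleting an element
cannot help, so all row sums, up to a global sign, are at least λ. If all such maximisers, in all
subsets of the ground set, had fewer than k elements, one could extract them successively: 31
disjoint ones of nearly maximal excess M would include 16 of the same sign, pairwise strongly
negatively correlated, and their union would beat M. Hence deleting O(k) elements halves the maximal
excess (`IsSignMatrix.exists_excess_le_half`). After about log₂ k halvings enough elements remain
for the Erdős–Spencer discrepancy bound to force excess above 2λk, so the original maximum exceeds
k², impossible for a set smaller than k.

The large set is then cut below 2k elements without losing row sums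
(`IsSignMatrix.exists_card_lt_two_mul`), sampled at density k/|S|, and corrected to size exactly k;
λ is chosen to absorb the sampling error and the correction. -/

open Finset

/-! ### Moments of random signed sums -/

section SignSums

variable {V : Type*} [DecidableEq V]

/-- The sum over `A` of `a`, with the sign of the terms outside `X` reversed. -/
def signSum (a : V → ℝ) (A X : Finset V) : ℝ :=
  ∑ u ∈ A, if u ∈ X then a u else -a u

theorem signSum_eq (a : V → ℝ) {A X : Finset V} (hX : X ⊆ A) :
    signSum a A X = ∑ u ∈ X, a u - ∑ u ∈ A \ X, a u := by
  unfold signSum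
  rw [← sum_sdiff hX, sub_eq_add_neg, ← sum_neg_distrib, add_comm]
  congr 1
  · exact sum_congr rfl fun u hu => by simp [hu]
  · exact sum_congr rfl fun u hu => by simp [(mem_sdiff.1 hu).2]

theorem sum_powerset_insert_signSum (a : V → ℝ) {A : Finset V} {w : V} (hw : w ∉ A) (φ : ℝ → ℝ) :
    ∑ X ∈ (insert w A).powerset, φ (signSum a (insert w A) X) =
      ∑ X ∈ A.powerset, (φ (signSum a A X - a w) + φ (signSum a A X + a w)) := by
  rw [sum_powerset_insert hw, ← sum_add_distrib]
  refine sum_congr rfl fun X hX => ?_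
  have hwX : w ∉ X := fun h => hw (mem_powerset.1 hX h)
  congr 2
  · simp only [signSum, sum_insert hw, hwX, if_false]
    ring
  · simp only [signSum, sum_insert hw, mem_insert_self, if_true]
    rw [add_comm]
    congr 1
    refine sum_congr rfl fun u hu => ?_
    have : u ≠ w := fun h => hw (h ▸ hu)
    simp [mem_insert, this]

theorem sum_powerset_signSum_sq (a : V → ℝ) (A : Finset V) :
    ∑ X ∈ A.powerset, signSum a A X ^ 2 = 2 ^ #A * ∑ u ∈ A, a u ^ 2 := by
  induction A using Finset.induction_on with
  | empty => simp [signSum]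
  | insert w A hw ih =>
    rw [sum_powerset_insert_signSum a hw (fun x => x ^ 2), card_insert_of_notMem hw, sum_insert hw]
    have h : ∀ x : ℝ, (x - a w) ^ 2 + (x + a w) ^ 2 = 2 * x ^ 2 + 2 * a w ^ 2 := fun x => by ring
    simp only [h, sum_add_distrib, ← mul_sum, ih, sum_const, card_powerset, nsmul_eq_mul]
    push_cast
    ring

theorem sum_powerset_signSum_pow_four_le (a : V → ℝ) (A : Finset V) :
    ∑ X ∈ A.powerset, signSum a A X ^ 4 ≤ 2 ^ #A * (3 * (∑ u ∈ A, a u ^ 2) ^ 2) := by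
  induction A using Finset.induction_on with
  | empty => simp [signSum]
  | insert w A hw ih =>
    rw [sum_powerset_insert_signSum a hw (fun x => x ^ 4), card_insert_of_notMem hw, sum_insert hw]
    have h : ∀ x : ℝ, (x - a w) ^ 4 + (x + a w) ^ 4 =
        2 * x ^ 4 + 12 * a w ^ 2 * x ^ 2 + 2 * a w ^ 4 := fun x => by ring
    simp only [h, sum_add_distrib, ← mul_sum, sum_powerset_signSum_sq, sum_const, card_powerset,
      nsmul_eq_mul]
    push_cast
    have h4 : 0 ≤ (2 : ℝ) ^ #A * a w ^ 4 := by positivity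
    rw [pow_succ (2 : ℝ)]
    linarith

/-- A Khinchine inequality: the second moment is q and the fourth at most 3q², so the first absolute
moment cannot be small. -/
theorem mul_sqrt_le_sum_powerset_abs_signSum (a : V → ℝ) (A : Finset V) :
    2 ^ #A * (√(∑ u ∈ A, a u ^ 2) / 4) ≤ ∑ X ∈ A.powerset, |signSum a A X| := by
  set q := ∑ u ∈ A, a u ^ 2 with hq
  have hq0 : 0 ≤ q := sum_nonneg fun u _ => sq_nonneg _
  rcases hq0.eq_or_lt with h | h
  · rw [← h]
    simpa using sum_nonneg fun X _ => abs_nonneg (signSum a A X)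
  set s := √q with hs
  have hs0 : 0 < s := Real.sqrt_pos.2 h
  have hsq : s ^ 2 = q := Real.sq_sqrt hq0
  -- With |x| = sy this is y² - y⁴/4 ≤ y. Averaging gives s - 3s/4 = s/4.
  have key : ∀ x : ℝ, x ^ 2 * (1 / s) - x ^ 4 * (1 / (4 * s ^ 3)) ≤ |x| := by
    intro x
    obtain ⟨y, hy⟩ : ∃ y, |x| = s * y := ⟨|x| / s, by field_simp⟩
    have hy0 : 0 ≤ y := by
      by_contra hneg
      have := abs_nonneg x
      nlinarith [mul_pos hs0 (neg_pos.2 (not_le.1 hneg))]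
    have h2 : x ^ 2 = (s * y) ^ 2 := by rw [← hy, sq_abs]
    have h4 : x ^ 4 = (s * y) ^ 4 := by
      calc x ^ 4 = (x ^ 2) ^ 2 := by ring
        _ = _ := by rw [h2]; ring
    rw [h2, h4, hy]
    have : (s * y) ^ 2 * (1 / s) - (s * y) ^ 4 * (1 / (4 * s ^ 3)) = s * (y ^ 2 - y ^ 4 / 4) := by
      field_simp
    rw [this]
    refine mul_le_mul_of_nonneg_left ?_ hs0.le
    have h1 : 0 ≤ y ^ 3 - 4 * y + 4 := by
      nlinarith [mul_nonneg hy0 (sq_nonneg (y - 1)), sq_nonneg (4 * y - 5)]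
    nlinarith [mul_nonneg hy0 h1]
  have h3 : (0 : ℝ) < 1 / (4 * s ^ 3) := by positivity
  calc 2 ^ #A * (s / 4)
      = 2 ^ #A * q * (1 / s) - 2 ^ #A * (3 * q ^ 2) * (1 / (4 * s ^ 3)) := by
        rw [← hsq]
        field_simp
        ring
    _ ≤ (∑ X ∈ A.powerset, signSum a A X ^ 2) * (1 / s) -
        (∑ X ∈ A.powerset, signSum a A X ^ 4) * (1 / (4 * s ^ 3)) := by
        rw [sum_powerset_signSum_sq]
        exact sub_le_sub_left (mul_le_mul_of_nonneg_right
          (sum_powerset_signSum_pow_four_le a A) h3.le) _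
    _ = ∑ X ∈ A.powerset,
        (signSum a A X ^ 2 * (1 / s) - signSum a A X ^ 4 * (1 / (4 * s ^ 3))) := by
        rw [sum_sub_distrib, sum_mul, sum_mul]
    _ ≤ _ := sum_le_sum fun X _ => key _

end SignSums

/-! ### Sign matrices and their discrepancy -/

section SignMatrix

variable {V : Type*}

/-- A symmetric matrix with zero diagonal and off-diagonal entries `1` and `-1`. -/
structure IsSignMatrix (f : V → V → ℝ) : Prop where
  symm : ∀ u v, f u v = f v u
  diag : ∀ u, f u u = 0
  off_diag : ∀ u v, u ≠ v → |f u v| = 1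

theorem IsSignMatrix.neg {f : V → V → ℝ} (hf : IsSignMatrix f) :
    IsSignMatrix fun u v => -f u v :=
  ⟨fun u v => by rw [hf.symm], fun u => by rw [hf.diag, neg_zero],
    fun u v h => by rw [abs_neg, hf.off_diag u v h]⟩

theorem IsSignMatrix.abs_le {f : V → V → ℝ} (hf : IsSignMatrix f) (u v : V) : |f u v| ≤ 1 := by
  by_cases h : u = v
  · rw [h, hf.diag]
    simp
  · exact (hf.off_diag u v h).le

/-- The sum of the entries of `f` with row in `S` and column in `T`. -/
def edgeSum (f : V → V → ℝ) (S T : Finset V) : ℝ :=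
  ∑ u ∈ S, ∑ v ∈ T, f u v

theorem IsSignMatrix.edgeSum_comm {f : V → V → ℝ} (hf : IsSignMatrix f) (S T : Finset V) :
    edgeSum f S T = edgeSum f T S := by
  unfold edgeSum
  rw [sum_comm]
  exact sum_congr rfl fun u _ => sum_congr rfl fun v _ => hf.symm _ _

theorem IsSignMatrix.abs_edgeSum_le {f : V → V → ℝ} (hf : IsSignMatrix f) (S T : Finset V) :
    |edgeSum f S T| ≤ #S * #T := by
  unfold edgeSum
  calc |∑ u ∈ S, ∑ v ∈ T, f u v| ≤ ∑ u ∈ S, ∑ v ∈ T, |f u v| :=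
        (abs_sum_le_sum_abs _ _).trans (sum_le_sum fun u _ => abs_sum_le_sum_abs _ _)
    _ ≤ ∑ u ∈ S, ∑ v ∈ T, (1 : ℝ) :=
        sum_le_sum fun u _ => sum_le_sum fun v _ => hf.abs_le u v
    _ = #S * #T := by simp

variable [DecidableEq V]

theorem edgeSum_union_left (f : V → V → ℝ) {S S' : Finset V} (h : Disjoint S S') (T : Finset V) :
    edgeSum f (S ∪ S') T = edgeSum f S T + edgeSum f S' T :=
  sum_union h

theorem edgeSum_union_right (f : V → V → ℝ) (S : Finset V) {T T' : Finset V}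
    (h : Disjoint T T') : edgeSum f S (T ∪ T') = edgeSum f S T + edgeSum f S T' := by
  unfold edgeSum
  rw [← sum_add_distrib]
  exact sum_congr rfl fun u _ => sum_union h

theorem IsSignMatrix.edgeSum_union_self {f : V → V → ℝ} (hf : IsSignMatrix f) {S T : Finset V}
    (h : Disjoint S T) : edgeSum f (S ∪ T) (S ∪ T) =
      edgeSum f S S + edgeSum f T T + 2 * edgeSum f S T := by
  rw [edgeSum_union_left f h, edgeSum_union_right f _ h, edgeSum_union_right f _ h,
    hf.edgeSum_comm T S]
  ring

theorem IsSignMatrix.edgeSum_erase {f : V → V → ℝ} (hf : IsSignMatrix f) {S : Finset V} {v : V}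
    (hv : v ∈ S) : edgeSum f (S.erase v) (S.erase v) =
      edgeSum f S S - 2 * ∑ u ∈ S, f v u := by
  have h := hf.edgeSum_union_self (disjoint_singleton_right.2 (notMem_erase v S))
  have hS : S.erase v ∪ {v} = S := by
    rw [union_comm, ← insert_eq, insert_erase hv]
  rw [hS, hf.edgeSum_comm (S.erase v) {v}] at h
  have h1 : edgeSum f {v} {v} = 0 := by simp [edgeSum, hf.diag]
  have h2 : edgeSum f {v} (S.erase v) = ∑ u ∈ S, f v u := by
    simp only [edgeSum, sum_singleton]
    exact sum_erase S (hf.diag v)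
  rw [h1, h2] at h
  linarith

theorem IsSignMatrix.edgeSum_insert {f : V → V → ℝ} (hf : IsSignMatrix f) {S : Finset V} {v : V}
    (hv : v ∉ S) : edgeSum f (insert v S) (insert v S) =
      edgeSum f S S + 2 * ∑ u ∈ S, f v u := by
  have h := hf.edgeSum_erase (mem_insert_self v S)
  rw [erase_insert hv, sum_insert hv, hf.diag] at h
  linarith

/-- Polarisation: it transfers bounds on principal submatrices to arbitrary rectangles, at the cost
of a factor 2. -/
theorem IsSignMatrix.two_mul_edgeSum {f : V → V → ℝ} (hf : IsSignMatrix f) (S T : Finset V) :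
    2 * edgeSum f S T = edgeSum f (S ∪ T) (S ∪ T) - edgeSum f (S \ T) (S \ T) -
      edgeSum f (T \ S) (T \ S) + edgeSum f (S ∩ T) (S ∩ T) := by
  have d1 : Disjoint (S \ T) (S ∩ T) := disjoint_sdiff_inter S T
  have d2 : Disjoint (T \ S) (S ∩ T) := by
    rw [inter_comm]
    exact disjoint_sdiff_inter T S
  have d3 : Disjoint S (T \ S) := disjoint_sdiff
  have e1 : S = S \ T ∪ S ∩ T := (sdiff_union_inter S T).symm
  have e2 : T = T \ S ∪ S ∩ T := by
    rw [inter_comm]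
    exact (sdiff_union_inter T S).symm
  have e3 : S ∪ T = S ∪ T \ S := union_sdiff_self_eq_union.symm
  have h1 : edgeSum f S T = edgeSum f S (T \ S) + edgeSum f S (S ∩ T) := by
    conv_lhs => rw [e2]
    exact edgeSum_union_right f S d2
  have h2 : edgeSum f S (S ∩ T) = edgeSum f (S \ T) (S ∩ T) + edgeSum f (S ∩ T) (S ∩ T) := by
    conv_lhs => enter [2]; rw [e1]
    exact edgeSum_union_left f d1 _
  have h3 := hf.edgeSum_union_self d1
  rw [← e1] at h3
  rw [e3, hf.edgeSum_union_self d3, h1, h2, h3]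
  ring

theorem IsSignMatrix.abs_edgeSum_le_of_forall {f : V → V → ℝ} (hf : IsSignMatrix f) {A : Finset V}
    {M : ℝ} (hM : ∀ X ⊆ A, |edgeSum f X X| ≤ M) {S T : Finset V} (hS : S ⊆ A) (hT : T ⊆ A) :
    |edgeSum f S T| ≤ 2 * M := by
  have h := hf.two_mul_edgeSum S T
  have h1 := _root_.abs_le.1 (hM _ (union_subset hS hT))
  have h2 := _root_.abs_le.1 (hM (S \ T) (sdiff_subset.trans hS))
  have h3 := _root_.abs_le.1 (hM (T \ S) (sdiff_subset.trans hT))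
  have h4 := _root_.abs_le.1 (hM (S ∩ T) (inter_subset_left.trans hS))
  rw [_root_.abs_le]
  constructor <;> linarith [h1.1, h1.2, h2.1, h2.2, h3.1, h3.2, h4.1, h4.2]

/-- Every sign matrix has a principal submatrix with large discrepancy (Erdős and Spencer). -/
theorem IsSignMatrix.exists_le_abs_edgeSum {f : V → V → ℝ} (hf : IsSignMatrix f) {A : Finset V}
    (hA : 2 ≤ #A) : ∃ X ⊆ A, #A * √(#A : ℝ) / 64 ≤ |edgeSum f X X| := by
  by_contra! hcon
  set N : ℝ := (#A : ℝ) with hN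
  have hN2 : (2 : ℝ) ≤ N := by
    rw [hN]
    exact_mod_cast hA
  have hsq : ∀ v ∈ A, ∑ u ∈ A, f v u ^ 2 = N - 1 := by
    intro v hv
    rw [← add_sum_erase A _ hv, hf.diag, sum_congr rfl (g := fun _ => (1 : ℝ))]
    · simp [card_erase_of_mem hv, hN, Nat.cast_sub (by lia : 1 ≤ #A)]
    · intro u hu
      rw [← sq_abs, hf.off_diag v u (ne_of_mem_erase hu).symm, one_pow]
  have havg : ∑ _X ∈ A.powerset, N * (√(N - 1) / 4) ≤
      ∑ X ∈ A.powerset, ∑ v ∈ A, |signSum (f v) A X| := by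
    rw [sum_comm, sum_const, card_powerset, nsmul_eq_mul]
    calc ((2 ^ #A : ℕ) : ℝ) * (N * (√(N - 1) / 4)) = ∑ v ∈ A, 2 ^ #A * (√(N - 1) / 4) := by
          simp [hN]
          ring
      _ ≤ _ := sum_le_sum fun v hv => by
          rw [← hsq v hv]
          exact mul_sqrt_le_sum_powerset_abs_signSum (f v) A
  obtain ⟨X, hX, hXle⟩ := exists_le_of_sum_le (powerset_nonempty A) havg
  rw [mem_powerset] at hX
  -- Splitting rows by the sign of their signed sum and columns by `X` turns the sum of absolute
  -- values into four rectangle sums, each at most twice the largest principal sum.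
  set P := A.filter fun v => 0 ≤ signSum (f v) A X with hP
  have hPA : P ⊆ A := filter_subset _ _
  have hsum : ∑ v ∈ A, |signSum (f v) A X| =
      edgeSum f P X - edgeSum f P (A \ X) - edgeSum f (A \ P) X + edgeSum f (A \ P) (A \ X) := by
    rw [← sum_sdiff hPA]
    have h1 : ∑ v ∈ P, |signSum (f v) A X| = edgeSum f P X - edgeSum f P (A \ X) := by
      unfold edgeSum
      rw [← sum_sub_distrib]
      refine sum_congr rfl fun v hv => ?_
      rw [abs_of_nonneg (mem_filter.1 hv).2, signSum_eq _ hX]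
    have h2 : ∑ v ∈ A \ P, |signSum (f v) A X| =
        -(edgeSum f (A \ P) X - edgeSum f (A \ P) (A \ X)) := by
      unfold edgeSum
      rw [← sum_sub_distrib, ← sum_neg_distrib]
      refine sum_congr rfl fun v hv => ?_
      have hneg : ¬ 0 ≤ signSum (f v) A X := fun h =>
        (mem_sdiff.1 hv).2 (mem_filter.2 ⟨(mem_sdiff.1 hv).1, h⟩)
      rw [abs_of_neg (not_le.1 hneg), signSum_eq _ hX]
    rw [h1, h2]
    ring
  obtain ⟨Y, hY, hYmax⟩ := exists_max_image A.powerset (fun Y => |edgeSum f Y Y|)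
    (powerset_nonempty A)
  have hM : ∀ Z ⊆ A, |edgeSum f Z Z| ≤ |edgeSum f Y Y| := fun Z hZ =>
    hYmax Z (mem_powerset.2 hZ)
  have b := fun {S T : Finset V} (hS : S ⊆ A) (hT : T ⊆ A) =>
    _root_.abs_le.1 (hf.abs_edgeSum_le_of_forall hM hS hT)
  have hbound : N * (√(N - 1) / 4) ≤ 8 * |edgeSum f Y Y| := by
    rw [hsum] at hXle
    linarith [(b hPA hX).2, (b hPA (sdiff_subset (s := A) (t := X))).1,
      (b (sdiff_subset (s := A) (t := P)) hX).1,
      (b (sdiff_subset (s := A) (t := P)) (sdiff_subset (s := A) (t := X))).2]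
  have hsqrt : √N / 2 ≤ √(N - 1) := by
    refine Real.le_sqrt_of_sq_le ?_
    rw [div_pow, Real.sq_sqrt (by linarith)]
    linarith
  have := hcon Y (mem_powerset.1 hY)
  nlinarith [mul_le_mul_of_nonneg_left hsqrt (by linarith : 0 ≤ N)]

end SignMatrix

/-! ### Large row sums from maximal excess -/

section Excess

variable {V : Type*}

/-- The absolute value of the sum of the principal submatrix of `f` on `S`, with a penalty of
`2 * lam` for each index. -/
def excess (f : V → V → ℝ) (lam : ℝ) (S : Finset V) : ℝ :=
  |edgeSum f S S| - 2 * lam * #S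

theorem edgeSum_neg (f : V → V → ℝ) (S T : Finset V) :
    edgeSum (fun u v => -f u v) S T = -edgeSum f S T := by
  simp [edgeSum]

theorem excess_neg (f : V → V → ℝ) (lam : ℝ) (S : Finset V) :
    excess (fun u v => -f u v) lam S = excess f lam S := by
  simp [excess, edgeSum_neg]

theorem exists_max_excess (f : V → V → ℝ) (lam : ℝ) (A : Finset V) :
    ∃ S ⊆ A, ∀ T ⊆ A, excess f lam T ≤ excess f lam S := by
  obtain ⟨S, hS, h⟩ := exists_max_image A.powerset (excess f lam) (powerset_nonempty A)
  exact ⟨S, mem_powerset.1 hS, fun T hT => h T (mem_powerset.2 hT)⟩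

variable [DecidableEq V]

/-- Deleting `v` lowers the sum by twice its row sum and saves a penalty of `2 * lam`; maximality
compares the two. -/
theorem IsSignMatrix.le_degree_of_max_excess {f : V → V → ℝ} (hf : IsSignMatrix f) {lam : ℝ}
    {A S : Finset V} (hSA : S ⊆ A) (hmax : ∀ T ⊆ A, excess f lam T ≤ excess f lam S)
    (hS : 0 ≤ edgeSum f S S) {v : V} (hv : v ∈ S) : lam ≤ ∑ u ∈ S, f v u := by
  have h := hmax (S.erase v) ((erase_subset v S).trans hSA)
  have hcard : (#(S.erase v) : ℝ) = #S - 1 := by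
    rw [card_erase_of_mem hv, Nat.cast_sub (card_pos.2 ⟨v, hv⟩), Nat.cast_one]
  unfold excess at h
  rw [hf.edgeSum_erase hv, hcard, abs_of_nonneg hS] at h
  linarith [le_abs_self (edgeSum f S S - 2 * ∑ u ∈ S, f v u)]

theorem edgeSum_biUnion {ι : Type*} (f : V → V → ℝ) {J : Finset ι} {S : ι → Finset V}
    (h : (J : Set ι).PairwiseDisjoint S) :
    edgeSum f (J.biUnion S) (J.biUnion S) = ∑ i ∈ J, ∑ j ∈ J, edgeSum f (S i) (S j) := by
  unfold edgeSum
  rw [sum_biUnion h]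
  refine sum_congr rfl fun i _ => ?_
  rw [sum_comm]
  rw [sum_biUnion h]
  exact sum_congr rfl fun j _ => sum_comm

/-- The union of many disjoint sets with positive sums and almost equal excess has a
larger excess. -/
theorem IsSignMatrix.lt_excess_biUnion {f : V → V → ℝ} (hf : IsSignMatrix f) {lam M : ℝ} {k : ℕ}
    (hlam : 0 ≤ lam) (hM : 0 < M) (hkM : 2 * lam * k ≤ M) {J : Finset ℕ} (hJ : #J = 16)
    {S : ℕ → Finset V} (hdisj : (J : Set ℕ).PairwiseDisjoint S)
    (hpos : ∀ i ∈ J, 0 ≤ edgeSum f (S i) (S i)) (hcard : ∀ i ∈ J, #(S i) ≤ k)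
    (hle : ∀ i ∈ J, excess f lam (S i) ≤ M) (hge : ∀ i ∈ J, M / 2 ≤ excess f lam (S i))
    (hun : ∀ i ∈ J, ∀ j ∈ J, i < j → excess f lam (S i ∪ S j) ≤ excess f lam (S i)) :
    M < excess f lam (J.biUnion S) := by
  -- Adjoining `S j` to `S i` would add the excess of `S j`, at least `M / 2`, plus twice the cross
  -- sum. As the excess does not grow, the cross sum must cancel this.
  have hlt : ∀ i ∈ J, ∀ j ∈ J, i < j → edgeSum f (S i) (S j) ≤ -(M / 4) := by
    intro i hi j hj hij
    have hd : Disjoint (S i) (S j) := hdisj hi hj hij.ne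
    have h1 := hun i hi j hj hij
    have h2 := hge j hj
    unfold excess at h1 h2
    rw [hf.edgeSum_union_self hd, card_union_of_disjoint hd, abs_of_nonneg (hpos i hi)] at h1
    rw [abs_of_nonneg (hpos j hj)] at h2
    push_cast at h1
    linarith [le_abs_self (edgeSum f (S i) (S i) + edgeSum f (S j) (S j) +
      2 * edgeSum f (S i) (S j))]
  have hne : ∀ i ∈ J, ∀ j ∈ J.erase i, edgeSum f (S i) (S j) ≤ -(M / 4) := by
    intro i hi j hj
    rcases lt_or_gt_of_ne (ne_of_mem_erase hj) with h | h
    · rw [hf.edgeSum_comm]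
      exact hlt j (mem_of_mem_erase hj) i hi h
    · exact hlt i hi j (mem_of_mem_erase hj) h
  have hcard' : ∀ i ∈ J, lam * #(S i) ≤ lam * k := fun i hi =>
    mul_le_mul_of_nonneg_left (by exact_mod_cast hcard i hi) hlam
  have hrow : ∀ i ∈ J, ∑ j ∈ J, edgeSum f (S i) (S j) ≤ M + 2 * lam * k - 15 * (M / 4) := by
    intro i hi
    rw [← add_sum_erase J _ hi]
    have h1 := hle i hi
    unfold excess at h1
    rw [abs_of_nonneg (hpos i hi)] at h1
    have h2 := sum_le_card_nsmul _ _ _ (hne i hi)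
    rw [card_erase_of_mem hi, hJ] at h2
    norm_num at h2
    linarith [hcard' i hi]
  have hsum := sum_le_card_nsmul _ _ _ hrow
  rw [← edgeSum_biUnion f hdisj, hJ] at hsum
  norm_num at hsum
  have hU : lam * (#(J.biUnion S) : ℝ) ≤ lam * (16 * k) := by
    refine mul_le_mul_of_nonneg_left ?_ hlam
    have := card_biUnion_le_card_mul J S k hcard
    rw [hJ] at this
    exact_mod_cast this
  -- The total is at most 16(M + 2λk - 15M/4), so the excess of the union is at least 44M - 64λk ≥
  -- 12M.
  unfold excess
  linarith [neg_abs_le (edgeSum f (J.biUnion S) (J.biUnion S))]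

/-- If maximisers of the excess are always small, then the maximal excess can be halved by removing
a bounded number of small sets. -/
theorem IsSignMatrix.exists_excess_le_half {f : V → V → ℝ} (hf : IsSignMatrix f) {lam M : ℝ}
    {k : ℕ} (hlam : 0 ≤ lam) (hM : 0 < M) (hkM : 2 * lam * k ≤ M) {A : Finset V}
    (hsmall : ∀ B ⊆ A, ∀ S ⊆ B, (∀ T ⊆ B, excess f lam T ≤ excess f lam S) → #S ≤ k)
    (hle : ∀ S ⊆ A, excess f lam S ≤ M) :
    ∃ B ⊆ A, #A ≤ #B + 31 * k ∧ ∀ S ⊆ B, excess f lam S ≤ M / 2 := by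
  choose F hFsub hFmax using exists_max_excess f lam
  -- Repeatedly remove a maximiser of the excess from what remains.
  set R : ℕ → Finset V := fun i => (fun B => B \ F B)^[i] A with hR
  have hR0 : R 0 = A := rfl
  have hRsucc : ∀ i, R (i + 1) = R i \ F (R i) := fun i => Function.iterate_succ_apply' _ i A
  have hanti : Antitone R := antitone_nat_of_succ_le fun i => by
    rw [hRsucc]
    exact sdiff_subset
  have hRA : ∀ i, R i ⊆ A := fun i => hanti (Nat.zero_le i)
  have hFk : ∀ i, #(F (R i)) ≤ k := fun i => hsmall _ (hRA i) _ (hFsub _) (hFmax _)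
  have hRcard : ∀ i, #A ≤ #(R i) + i * k := by
    intro i
    induction i with
    | zero => simp [hR0]
    | succ i ih =>
      have h1 := card_sdiff_add_card_eq_card (hFsub (R i))
      rw [← hRsucc] at h1
      have h2 := hFk i
      rw [add_mul, one_mul]
      lia
  by_contra! hcon
  have hge : ∀ i ∈ range 31, M / 2 ≤ excess f lam (F (R i)) := by
    intro i hi
    have hi' : i * k ≤ 31 * k := Nat.mul_le_mul_right k (mem_range.1 hi).le
    obtain ⟨S, hS, hlt⟩ := hcon (R i) (hRA i) (by have := hRcard i; lia)
    exact hlt.le.trans (hFmax _ S hS)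
  have hsub : ∀ {i j}, i < j → F (R j) ⊆ R i \ F (R i) := fun {i j} hij => by
    rw [← hRsucc]
    exact (hFsub _).trans (hanti hij)
  have hdisj : ∀ J : Finset ℕ, (J : Set ℕ).PairwiseDisjoint fun i => F (R i) := by
    intro J i _ j _ hij
    rcases lt_or_gt_of_ne hij with h | h
    · exact (disjoint_sdiff.mono_right (hsub h))
    · exact (disjoint_sdiff.mono_right (hsub h)).symm
  have hun : ∀ i j, i < j → excess f lam (F (R i) ∪ F (R j)) ≤ excess f lam (F (R i)) :=
    fun i j hij => hFmax _ _ (union_subset (hFsub _) ((hsub hij).trans sdiff_subset))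
  have hfin : ∀ J : Finset ℕ, excess f lam (J.biUnion fun i => F (R i)) ≤ M := fun J =>
    hle _ (biUnion_subset.2 fun i _ => (hFsub _).trans (hRA i))
  have hFle : ∀ i, excess f lam (F (R i)) ≤ M := fun i => hle _ ((hFsub _).trans (hRA i))
  set P := (range 31).filter fun i => 0 ≤ edgeSum f (F (R i)) (F (R i)) with hP
  have hPN : #P + #((range 31).filter fun i => ¬ 0 ≤ edgeSum f (F (R i)) (F (R i))) = 31 := by
    rw [hP, card_filter_add_card_filter_not, card_range]
  -- Among 31 = 2·16 - 1 sets, 16 have sums of the same sign; negating `f` reduces the second case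
  -- to the first.
  rcases le_or_gt 16 #P with h | h
  · obtain ⟨J, hJP, hJ⟩ := exists_subset_card_eq h
    refine (hf.lt_excess_biUnion hlam hM hkM hJ (hdisj J) (fun i hi => (mem_filter.1 (hJP hi)).2)
      (fun i _ => hFk i) (fun i _ => hFle i) (fun i hi => hge i (mem_filter.1 (hJP hi)).1)
      fun i _ j _ => hun i j).not_ge (hfin J)
  · obtain ⟨J, hJP, hJ⟩ := exists_subset_card_eq (n := 16)
      (s := (range 31).filter fun i => ¬ 0 ≤ edgeSum f (F (R i)) (F (R i))) (by lia)
    have := hf.neg.lt_excess_biUnion (S := fun i => F (R i)) hlam hM hkM hJ (hdisj J)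
      (fun i hi => by
        rw [edgeSum_neg]
        linarith [(mem_filter.1 (hJP hi)).2])
      (fun i _ => hFk i) (fun i _ => by rw [excess_neg]; exact hFle i)
      (fun i hi => by rw [excess_neg]; exact hge i (mem_filter.1 (hJP hi)).1)
      (fun i _ j _ hij => by rw [excess_neg, excess_neg]; exact hun i j hij)
    rw [excess_neg] at this
    exact this.not_ge (hfin J)

/-- Iterated halving: `j` rounds cost at most `31 * k * j` elements, and the `N` that remain still
carry excess above `2 * lam * k`. -/
theorem IsSignMatrix.mul_two_pow_lt_of_small_maximisers {f : V → V → ℝ} (hf : IsSignMatrix f)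
    {lam : ℝ} {k N : ℕ} (hlam : 0 ≤ lam) (j : ℕ) : ∀ {A : Finset V} {M : ℝ},
    (∀ B ⊆ A, ∀ S ⊆ B, (∀ T ⊆ B, excess f lam T ≤ excess f lam S) → #S ≤ k) →
    (∀ B ⊆ A, N ≤ #B → ∃ X ⊆ B, 2 * lam * k < excess f lam X) →
    (∀ S ⊆ A, excess f lam S ≤ M) → N + 31 * k * j ≤ #A → 2 * lam * k * 2 ^ j < M := by
  induction j with
  | zero =>
    intro A M _ hbig hM hA
    obtain ⟨X, hX, hlt⟩ := hbig A subset_rfl (by simpa using hA)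
    simpa using hlt.trans_le (hM X hX)
  | succ j ih =>
    intro A M hsmall hbig hM hA
    rw [mul_add, mul_one] at hA
    obtain ⟨X, hX, hlt⟩ := hbig A subset_rfl (by lia)
    have hkM := hlt.trans_le (hM X hX)
    have h0 : 0 ≤ 2 * lam * k := by positivity
    obtain ⟨B, hBA, hcard, hB⟩ :=
      hf.exists_excess_le_half hlam (h0.trans_lt hkM) hkM.le hsmall hM
    have := ih (fun C hC => hsmall C (hC.trans hBA)) (fun C hC => hbig C (hC.trans hBA)) hB
      (by lia)
    rw [pow_succ]
    linarith

/-- A large sign matrix has, up to sign, a large principal submatrix with large row sums. -/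
theorem IsSignMatrix.exists_large_le_degree {f : V → V → ℝ} (hf : IsSignMatrix f) {lam : ℝ}
    {k N j : ℕ} (hlam : 1 ≤ lam) (hk : 2 ≤ k) (hN : (512 * lam) ^ 2 ≤ N) (hkN : k ≤ N)
    (hkj : k ≤ 2 ^ j) {A : Finset V} (hA : N + 31 * k * j ≤ #A) :
    ∃ S ⊆ A, k ≤ #S ∧
      ((∀ v ∈ S, lam ≤ ∑ u ∈ S, f v u) ∨ ∀ v ∈ S, lam ≤ ∑ u ∈ S, -f v u) := by
  by_contra! hcon
  have hlam0 : 0 ≤ lam := by linarith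
  have hsmall : ∀ B ⊆ A, ∀ S ⊆ B, (∀ T ⊆ B, excess f lam T ≤ excess f lam S) → #S < k := by
    intro B hB S hS hmax
    by_contra! hle
    obtain ⟨⟨v, hv, hlt⟩, w, hw, hlt'⟩ := hcon S (hS.trans hB) hle
    rcases le_total 0 (edgeSum f S S) with h | h
    · exact (hf.le_degree_of_max_excess hS hmax h hv).not_gt hlt
    · refine (hf.neg.le_degree_of_max_excess (lam := lam) hS ?_ ?_ hw).not_gt hlt'
      · simpa only [excess_neg] using hmax
      · rw [edgeSum_neg]
        linarith
  have hbig : ∀ B ⊆ A, N ≤ #B → ∃ X ⊆ B, 2 * lam * k < excess f lam X := by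
    intro B _ hB
    obtain ⟨B', hB', hcard⟩ := exists_subset_card_eq hB
    obtain ⟨X, hX, hle⟩ := hf.exists_le_abs_edgeSum (A := B') (by lia)
    refine ⟨X, hX.trans hB', ?_⟩
    have hsqrt : 512 * lam ≤ √(#B' : ℝ) := by
      rw [hcard]
      exact Real.le_sqrt_of_sq_le hN
    have hXB : (#X : ℝ) ≤ #B' := by exact_mod_cast card_le_card hX
    have hkB : (k : ℝ) ≤ #B' := by
      rw [hcard]
      exact_mod_cast hkN
    have hk0 : (0 : ℝ) < k := by exact_mod_cast (by lia : 0 < k)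
    -- Here 512 = 64·8: the discrepancy is at least 8λ|B'|, the penalty at most 2λ|B'|, and 6λ|B'| >
    -- 2λk is left.
    have h1 : #B' * (8 * lam) ≤ #B' * √(#B' : ℝ) / 64 := by
      rw [mul_div_assoc]
      exact mul_le_mul_of_nonneg_left (by linarith) (by positivity)
    have h2 : lam * #X ≤ lam * #B' := mul_le_mul_of_nonneg_left hXB hlam0
    have h3 : lam * k ≤ lam * #B' := mul_le_mul_of_nonneg_left hkB hlam0
    have h4 : 0 < lam * k := by positivity
    unfold excess
    linarith
  obtain ⟨S, hS, hmax⟩ := exists_max_excess f lam A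
  have := hf.mul_two_pow_lt_of_small_maximisers hlam0 j
    (fun B hB S hS hmax => (hsmall B hB S hS hmax).le) hbig hmax hA
  have hSk : (#S : ℝ) ≤ k := by exact_mod_cast (hsmall A subset_rfl S hS hmax).le
  have hS0 : (0 : ℝ) ≤ #S := by positivity
  have h1 := hf.abs_edgeSum_le S S
  have h2 : (k : ℝ) ≤ 2 ^ j := by exact_mod_cast hkj
  unfold excess at this
  have hk0 : (0 : ℝ) < k := by exact_mod_cast (by lia : 0 < k)
  -- The maximal excess would exceed k², while a set of fewer than `k` elements has sum at most k².
  have h3 : (k : ℝ) * k ≤ 2 * lam * k * 2 ^ j := by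
    calc (k : ℝ) * k ≤ k * 2 ^ j := by gcongr
      _ ≤ 2 * lam * (k * 2 ^ j) := le_mul_of_one_le_left (by positivity) (by linarith)
      _ = _ := by ring
  have h4 : (#S : ℝ) * #S ≤ k * k := by gcongr
  have h5 : 0 ≤ 2 * lam * #S := by positivity
  linarith

end Excess

/-! ### Reduction to fewer than 2k elements -/

section Reduction

variable {V : Type*}

theorem IsSignMatrix.exists_int_sum_eq {f : V → V → ℝ} (hf : IsSignMatrix f) (S : Finset V)
    (v : V) : ∃ z : ℤ, ∑ u ∈ S, f v u = z := by
  have h : ∀ u, ∃ z : ℤ, f v u = z := by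
    intro u
    by_cases huv : v = u
    · exact ⟨0, by rw [huv, hf.diag, Int.cast_zero]⟩
    · rcases eq_or_eq_neg_of_abs_eq (hf.off_diag v u huv) with h | h
      · exact ⟨1, by rw [h, Int.cast_one]⟩
      · exact ⟨-1, by rw [h, Int.cast_neg, Int.cast_one]⟩
  choose z hz using h
  exact ⟨∑ u ∈ S, z u, by simp [hz]⟩

/-- Large row sums pass to a principal submatrix of size less than `2 * k`, unless there is one of
size `k` with nonnegative row sums. -/
theorem IsSignMatrix.exists_card_lt_two_mul {f : V → V → ℝ} (hf : IsSignMatrix f) {lam : ℝ}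
    {k : ℕ} {S : Finset V} (hS : k ≤ #S)
    (hdeg : ∀ v ∈ S, lam ≤ ∑ u ∈ S, f v u) :
    (∃ T ⊆ S, #T = k ∧ ∀ v ∈ T, 0 ≤ ∑ u ∈ T, f v u) ∨
      ∃ T ⊆ S, k ≤ #T ∧ #T < 2 * k ∧ ∀ v ∈ T, lam ≤ ∑ u ∈ T, f v u := by
  classical
  induction S using Finset.strongInduction with
  | H S ih =>
  rcases lt_or_ge (#S) (2 * k) with hlt | hge
  · exact Or.inr ⟨S, subset_rfl, hS, hlt, hdeg⟩
  obtain ⟨T, hT, hmax⟩ := exists_max_image (S.powersetCard k) (fun T => edgeSum f T T)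
    (powersetCard_nonempty.2 hS)
  obtain ⟨hTS, hTk⟩ := mem_powersetCard.1 hT
  by_cases hgood : ∀ v ∈ T, 0 ≤ ∑ u ∈ T, f v u
  · exact Or.inl ⟨T, hTS, hTk, hgood⟩
  push Not at hgood
  obtain ⟨u, hu, hneg⟩ := hgood
  have hk : 0 < k := hTk ▸ card_pos.2 ⟨u, hu⟩
  -- Exchanging `u` for `v` cannot increase the sum, so the row sum of `v` over `T` is at most that
  -- of `u` plus `f v u`. By integrality the former is at most -1, so the total is at most 0.
  -- Removing `T` thus lowers no remaining row sum.
  have hout : ∀ v ∈ S \ T, ∑ w ∈ T, f v w ≤ 0 := by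
    intro v hv
    obtain ⟨hvS, hvT⟩ := mem_sdiff.1 hv
    have hvT' : v ∉ T.erase u := fun h => hvT (mem_of_mem_erase h)
    have h := hmax (insert v (T.erase u)) (mem_powersetCard.2
      ⟨insert_subset hvS ((erase_subset u T).trans hTS), by
        rw [card_insert_of_notMem hvT', card_erase_of_mem hu]
        lia⟩)
    rw [hf.edgeSum_insert hvT', hf.edgeSum_erase hu] at h
    have h1 := add_sum_erase T (fun w => f v w) hu
    have h2 := (_root_.abs_le.1 (hf.abs_le v u)).2
    have h3 : ∑ w ∈ T, f u w ≤ -1 := by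
      obtain ⟨z, hz⟩ := hf.exists_int_sum_eq T u
      rw [hz] at hneg ⊢
      exact_mod_cast Int.le_sub_one_of_lt (by exact_mod_cast hneg : z < 0)
    linarith
  have hcard := card_sdiff_add_card_eq_card hTS
  have hss : S \ T ⊂ S := sdiff_ssubset hTS ⟨u, hu⟩
  rcases ih (S \ T) hss (by lia) (fun v hv => by
    have h1 := hdeg v (mem_sdiff.1 hv).1
    rw [← sum_sdiff hTS] at h1
    linarith [hout v hv]) with ⟨U, hU, h⟩ | ⟨U, hU, h⟩
  · exact Or.inl ⟨U, hU.trans sdiff_subset, h⟩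
  · exact Or.inr ⟨U, hU.trans sdiff_subset, h⟩

end Reduction

/-! ### Random subsets and Chernoff bounds -/

section Sampling

variable {V : Type*} [DecidableEq V]

theorem sum_powerset_weight_mul_prod (p : ℝ) (S : Finset V) (x : V → ℝ) :
    ∑ T ∈ S.powerset, p ^ #T * (1 - p) ^ #(S \ T) * ∏ u ∈ T, x u =
      ∏ u ∈ S, (p * x u + (1 - p)) := by
  rw [prod_add]
  refine sum_congr rfl fun T _ => ?_
  rw [prod_mul_distrib, prod_const, prod_const]
  ring

theorem one_sub_add_mul_exp_le {p x : ℝ} (hp0 : 0 ≤ p) (hp1 : p ≤ 1) (hx : |x| ≤ 1) :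
    p * Real.exp x + (1 - p) ≤ Real.exp (p * x + x ^ 2) := by
  have h1 := (abs_le.1 (Real.abs_exp_sub_one_sub_id_le hx)).2
  have h2 := Real.add_one_le_exp (p * x + x ^ 2)
  nlinarith [mul_le_mul_of_nonneg_left h1 hp0, mul_le_mul_of_nonneg_right hp1 (sq_nonneg x)]

/-- The lower tail bound for sums over a random subset containing each element with
probability `p`. -/
theorem sum_weight_lower_tail_le {p s : ℝ} (hp0 : 0 ≤ p) (hp1 : p ≤ 1) {S : Finset V}
    (hs0 : 0 < s) (hs : s ≤ 2 * #S) {a : V → ℝ} (ha : ∀ u ∈ S, |a u| ≤ 1) :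
    ∑ T ∈ S.powerset with ∑ u ∈ T, a u ≤ p * ∑ u ∈ S, a u - s, p ^ #T * (1 - p) ^ #(S \ T) ≤
      Real.exp (-(s ^ 2 / (4 * #S))) := by
  have hl : (0 : ℝ) < #S := by linarith
  -- This minimises the Chernoff exponent -ts + t²|S|; `hs` says exactly that t ≤ 1, as the bound on
  -- the exponential requires.
  set t := s / (2 * #S) with ht
  have ht0 : 0 < t := by positivity
  have ht1 : t ≤ 1 := by
    rw [ht, div_le_one (by positivity)]
    exact hs
  set m := p * ∑ u ∈ S, a u with hm
  have hw : ∀ T : Finset V, 0 ≤ p ^ #T * (1 - p) ^ #(S \ T) := fun T =>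
    mul_nonneg (pow_nonneg hp0 _) (pow_nonneg (by linarith) _)
  have hmoment : ∑ T ∈ S.powerset, p ^ #T * (1 - p) ^ #(S \ T) * ∏ u ∈ T, Real.exp (-t * a u) ≤
      Real.exp (-t * m + t ^ 2 * #S) := by
    rw [sum_powerset_weight_mul_prod]
    calc ∏ u ∈ S, (p * Real.exp (-t * a u) + (1 - p))
        ≤ ∏ u ∈ S, Real.exp (p * (-t * a u) + t ^ 2) := by
          refine prod_le_prod (fun u _ => ?_) fun u hu => ?_
          · have := Real.exp_pos (-t * a u)
            nlinarith [mul_nonneg hp0 this.le]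
          · have h1 : |-t * a u| ≤ 1 := by
              rw [abs_mul, abs_neg, abs_of_pos ht0]
              exact mul_le_one₀ ht1 (abs_nonneg _) (ha u hu)
            refine (one_sub_add_mul_exp_le hp0 hp1 h1).trans (Real.exp_le_exp.2 ?_)
            have h2 : a u ^ 2 ≤ 1 := by
              rw [← sq_abs]
              exact pow_le_one₀ (abs_nonneg _) (ha u hu)
            nlinarith [mul_le_mul_of_nonneg_left h2 (sq_nonneg t)]
      _ = _ := by
          rw [← Real.exp_sum]
          congr 1
          rw [sum_add_distrib, sum_const, nsmul_eq_mul, hm, mul_left_comm, mul_sum, mul_sum]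
          rw [mul_comm (t ^ 2)]
  calc ∑ T ∈ S.powerset with ∑ u ∈ T, a u ≤ m - s, p ^ #T * (1 - p) ^ #(S \ T)
      ≤ ∑ T ∈ S.powerset with ∑ u ∈ T, a u ≤ m - s, p ^ #T * (1 - p) ^ #(S \ T) *
          (Real.exp (t * (m - s)) * ∏ u ∈ T, Real.exp (-t * a u)) := by
        refine sum_le_sum fun T hT => le_mul_of_one_le_right (hw T) ?_
        rw [← Real.exp_sum, ← Real.exp_add, ← mul_sum]
        refine Real.one_le_exp ?_
        have := mul_le_mul_of_nonneg_left (mem_filter.1 hT).2 ht0.le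
        linarith
    _ ≤ ∑ T ∈ S.powerset, p ^ #T * (1 - p) ^ #(S \ T) *
          (Real.exp (t * (m - s)) * ∏ u ∈ T, Real.exp (-t * a u)) :=
        sum_le_sum_of_subset_of_nonneg (filter_subset _ _) fun T _ _ =>
          mul_nonneg (hw T) (mul_nonneg (Real.exp_pos _).le
            (prod_nonneg fun u _ => (Real.exp_pos _).le))
    _ = Real.exp (t * (m - s)) * ∑ T ∈ S.powerset, p ^ #T * (1 - p) ^ #(S \ T) *
          ∏ u ∈ T, Real.exp (-t * a u) := by
        rw [mul_sum]
        exact sum_congr rfl fun T _ => by ring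
    _ ≤ Real.exp (t * (m - s)) * Real.exp (-t * m + t ^ 2 * #S) :=
        mul_le_mul_of_nonneg_left hmoment (Real.exp_pos _).le
    _ = _ := by
        rw [← Real.exp_add]
        congr 1
        rw [ht]
        field_simp
        ring

/-- A finite family of bounded weights has a common subset on which all sums are at least their
expected values, up to a small error. -/
theorem exists_subset_forall_lt_sum {ι : Type*} {p s : ℝ} (hp0 : 0 ≤ p) (hp1 : p ≤ 1)
    {S : Finset V} (hs0 : 0 < s) (hs : s ≤ 2 * #S) (I : Finset ι) (a : ι → V → ℝ)
    (ha : ∀ i ∈ I, ∀ u ∈ S, |a i u| ≤ 1) (hI : #I * Real.exp (-(s ^ 2 / (4 * #S))) < 1) :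
    ∃ T ⊆ S, ∀ i ∈ I, p * ∑ u ∈ S, a i u - s < ∑ u ∈ T, a i u := by
  by_contra! hcon
  have hw : ∀ T : Finset V, 0 ≤ p ^ #T * (1 - p) ^ #(S \ T) := fun T =>
    mul_nonneg (pow_nonneg hp0 _) (pow_nonneg (by linarith) _)
  have hone : ∑ T ∈ S.powerset, p ^ #T * (1 - p) ^ #(S \ T) = 1 := by
    simpa using sum_powerset_weight_mul_prod p S 1
  refine hI.not_ge ?_
  calc 1 = ∑ T ∈ S.powerset, p ^ #T * (1 - p) ^ #(S \ T) := hone.symm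
    _ ≤ ∑ T ∈ S.powerset, ∑ i ∈ I,
        if ∑ u ∈ T, a i u ≤ p * ∑ u ∈ S, a i u - s then p ^ #T * (1 - p) ^ #(S \ T) else 0 := by
        refine sum_le_sum fun T hT => ?_
        obtain ⟨i, hi, hle⟩ := hcon T (mem_powerset.1 hT)
        refine le_trans ?_ (single_le_sum (fun j _ => ?_) hi)
        · rw [if_pos hle]
        · split_ifs
          exacts [hw T, le_rfl]
    _ = ∑ i ∈ I, ∑ T ∈ S.powerset with ∑ u ∈ T, a i u ≤ p * ∑ u ∈ S, a i u - s,
        p ^ #T * (1 - p) ^ #(S \ T) := by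
        rw [sum_comm]
        exact sum_congr rfl fun i _ => (sum_filter _ _).symm
    _ ≤ ∑ _i ∈ I, Real.exp (-(s ^ 2 / (4 * #S))) :=
        sum_le_sum fun i hi => sum_weight_lower_tail_le hp0 hp1 hs0 hs (ha i hi)
    _ = _ := by simp

end Sampling

/-! ### Sets of size exactly k -/

section ExactSize

variable {V : Type*}

theorem IsSignMatrix.abs_sum_le_card {f : V → V → ℝ} (hf : IsSignMatrix f) (S : Finset V)
    (v : V) : |∑ u ∈ S, f v u| ≤ #S := by
  refine (abs_sum_le_sum_abs _ _).trans ?_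
  simpa using sum_le_sum fun u (_ : u ∈ S) => hf.abs_le v u

/-- Large row sums on a set of size between `k` and `2 * k` give nonnegative row sums on some
subset of size exactly `k`. -/
theorem IsSignMatrix.exists_card_eq_of_le_degree {f : V → V → ℝ} (hf : IsSignMatrix f) {k : ℕ}
    (hk : 2 ≤ k) {S : Finset V} (hkS : k ≤ #S) (hSk : #S < 2 * k)
    (hdeg : ∀ v ∈ S, 4 * √(32 * k * Real.log k) ≤ ∑ u ∈ S, f v u) :
    ∃ T ⊆ S, #T = k ∧ ∀ v ∈ T, 0 ≤ ∑ u ∈ T, f v u := by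
  classical
  have hk2 : (2 : ℝ) ≤ k := by exact_mod_cast hk
  have hk0 : (0 : ℝ) < k := by linarith
  have hL : 0 < Real.log k := Real.log_pos (by linarith)
  have hkS' : (k : ℝ) ≤ #S := by exact_mod_cast hkS
  have hSk' : (#S : ℝ) ≤ 2 * k := by exact_mod_cast hSk.le
  have hS0 : (0 : ℝ) < #S := by linarith
  set s := √(32 * k * Real.log k) with hs
  have hs0 : 0 < s := Real.sqrt_pos.2 (by positivity)
  have hsq : s ^ 2 = 32 * k * Real.log k := Real.sq_sqrt (by positivity)
  obtain ⟨v₀, hv₀⟩ : S.Nonempty := card_pos.1 (by lia)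
  have hsS : s ≤ 2 * #S := by
    linarith [hdeg v₀ hv₀, (_root_.abs_le.1 (hf.abs_sum_le_card S v₀)).2]
  have hI : (#(S.disjSum (univ : Finset Bool)) : ℝ) * Real.exp (-(s ^ 2 / (4 * #S))) < 1 := by
    -- Since |S| ≤ 2k, the constant 32 makes each failure probability at most k⁻⁴, against at most
    -- 2k + 1 events.
    have h1 : Real.log ((k : ℝ) ^ 4) ≤ s ^ 2 / (4 * #S) := by
      rw [Real.log_pow, hsq, le_div_iff₀ (by positivity)]
      push_cast
      nlinarith [mul_le_mul_of_nonneg_left hSk' hL.le]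
    have h2 : Real.exp (-(s ^ 2 / (4 * #S))) ≤ ((k : ℝ) ^ 4)⁻¹ := by
      rw [← Real.exp_log (by positivity : (0 : ℝ) < (k : ℝ) ^ 4), ← Real.exp_neg]
      exact Real.exp_le_exp.2 (neg_le_neg h1)
    have h3 : (#(S.disjSum (univ : Finset Bool)) : ℝ) < (k : ℝ) ^ 4 := by
      rw [card_disjSum]
      have h4 : 8 * k ≤ k ^ 4 := by
        calc 8 * k = 2 ^ 3 * k := by norm_num
          _ ≤ k ^ 3 * k := by gcongr
          _ = k ^ 4 := by ring
      have h5 : #S + #(univ : Finset Bool) < k ^ 4 := by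
        rw [card_univ, Fintype.card_bool]
        lia
      exact_mod_cast h5
    calc _ ≤ (#(S.disjSum (univ : Finset Bool)) : ℝ) * ((k : ℝ) ^ 4)⁻¹ :=
          mul_le_mul_of_nonneg_left h2 (by positivity)
      _ < 1 := by rwa [← div_eq_mul_inv, div_lt_one (by positivity)]
  have hp1 : (k : ℝ) / #S ≤ 1 := (div_le_one hS0).2 hkS'
  have hp2 : 1 / 2 ≤ (k : ℝ) / #S := by
    rw [le_div_iff₀ hS0]
    linarith
  -- Besides the rows of `f`, the constant weights 1 and -1 control |T| from below and above.
  obtain ⟨T, hTS, hT⟩ := exists_subset_forall_lt_sum (p := k / #S) (by positivity) hp1 hs0 hsS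
    (S.disjSum univ) (Sum.elim f fun b _ => if b then 1 else -1) (by
      rintro (v | b) _ u _
      · exact hf.abs_le v u
      · cases b <;> simp) hI
  have hcard : (k : ℝ) / #S * #S = k := div_mul_cancel₀ _ hS0.ne'
  have hlow : (k : ℝ) - s < #T := by
    have := hT (Sum.inr true) (by simp)
    simp only [Sum.elim_inr, if_true, sum_const, nsmul_eq_mul, mul_one, hcard] at this
    exact this
  have hup : (#T : ℝ) < k + s := by
    have := hT (Sum.inr false) (by simp)
    simp only [Sum.elim_inr, Bool.false_eq_true, if_false, sum_const, nsmul_eq_mul, mul_neg,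
      mul_one, hcard] at this
    linarith
  -- As p ≥ 1/2, the expected row sum is at least 2s. The surplus s pays for adding or deleting
  -- fewer than s elements.
  have hTdeg : ∀ v ∈ S, s < ∑ u ∈ T, f v u := by
    intro v hv
    have h1 := hT (Sum.inl v) (by simpa using hv)
    simp only [Sum.elim_inl] at h1
    nlinarith [mul_le_mul hp2 (hdeg v hv) (by positivity) (by positivity)]
  rcases le_total (#T) k with hle | hle
  · obtain ⟨U, hTU, hUS, hU⟩ := exists_subsuperset_card_eq hTS hle hkS
    refine ⟨U, hUS, hU, fun v hv => ?_⟩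
    have h1 := hTdeg v (hUS hv)
    have h2 := (_root_.abs_le.1 (hf.abs_sum_le_card (U \ T) v)).1
    have h3 : (#(U \ T) : ℝ) + #T = k := by
      exact_mod_cast (card_sdiff_add_card_eq_card hTU).trans hU
    rw [← sum_sdiff hTU]
    linarith
  · obtain ⟨U, hUT, hU⟩ := exists_subset_card_eq hle
    refine ⟨U, hUT.trans hTS, hU, fun v hv => ?_⟩
    have h1 := hTdeg v (hTS (hUT hv))
    have h2 := (_root_.abs_le.1 (hf.abs_sum_le_card (T \ U) v)).2
    have h3 : (#(T \ U) : ℝ) + k = #T := by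
      exact_mod_cast hU ▸ card_sdiff_add_card_eq_card hUT
    rw [← sum_sdiff hUT] at h1
    linarith

theorem IsSignMatrix.exists_card_eq_nonneg_degree [Fintype V] {f : V → V → ℝ}
    (hf : IsSignMatrix f) {k : ℕ} (hk : 2 ≤ k)
    (hV : 2 ^ 28 * (k : ℝ) * Real.log k ≤ Fintype.card V) :
    ∃ S : Finset V, #S = k ∧
      ((∀ v ∈ S, 0 ≤ ∑ u ∈ S, f v u) ∨ ∀ v ∈ S, 0 ≤ ∑ u ∈ S, -f v u) := by
  classical
  have hk2 : (2 : ℝ) ≤ k := by exact_mod_cast hk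
  have hlog2 : 1 / 2 < Real.log 2 := by linarith [Real.log_two_gt_d9]
  have hL : Real.log 2 ≤ Real.log k := Real.log_le_log (by norm_num) hk2
  have hkL : (k : ℝ) * (1 / 2) ≤ k * Real.log k :=
    mul_le_mul_of_nonneg_left (by linarith) (by linarith)
  have hkL0 : (0 : ℝ) ≤ 32 * k * Real.log k := by linarith
  set lam := 4 * √(32 * k * Real.log k) with hlam
  have hlamsq : lam ^ 2 = 512 * (k * Real.log k) := by
    rw [hlam, mul_pow, Real.sq_sqrt hkL0]
    ring
  have hlam1 : 1 ≤ lam := by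
    have h0 : 0 ≤ lam := by positivity
    nlinarith
  -- Here 2²⁷ = 512² · 512, from (512λ)² with λ² = 512 k log k. The other half of 2²⁸ covers the
  -- rounding and the halving cost, at most 124 k log k.
  set N := ⌈2 ^ 27 * ((k : ℝ) * Real.log k)⌉₊ with hN
  have hNle : 2 ^ 27 * ((k : ℝ) * Real.log k) ≤ N := Nat.le_ceil _
  have hNlt : (N : ℝ) < 2 ^ 27 * ((k : ℝ) * Real.log k) + 1 :=
    Nat.ceil_lt_add_one (by linarith)
  have hkN : k ≤ N := by
    have : (k : ℝ) ≤ N := by linarith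
    exact_mod_cast this
  have hj : (Nat.clog 2 k : ℝ) ≤ 4 * Real.log k := by
    have h1 : 2 ^ Nat.clog 2 k ≤ k * k := by
      have h2 : 2 ^ (Nat.clog 2 k - 1) < k := Nat.pow_pred_clog_lt_self (by norm_num) (by lia)
      have h3 : 0 < Nat.clog 2 k := Nat.clog_pos (by norm_num) hk
      calc 2 ^ Nat.clog 2 k = 2 * 2 ^ (Nat.clog 2 k - 1) := by
            rw [← pow_succ', Nat.sub_add_cancel h3]
        _ ≤ k * k := Nat.mul_le_mul hk h2.le
    have h4 : Real.log ((2 : ℝ) ^ Nat.clog 2 k) ≤ Real.log ((k : ℝ) * k) :=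
      Real.log_le_log (by positivity) (by exact_mod_cast h1)
    rw [Real.log_pow, Real.log_mul (by positivity) (by positivity)] at h4
    have h5 : (Nat.clog 2 k : ℝ) * (1 / 2) ≤ Nat.clog 2 k * Real.log 2 :=
      mul_le_mul_of_nonneg_left hlog2.le (by positivity)
    linarith
  have hA : N + 31 * k * Nat.clog 2 k ≤ #(univ : Finset V) := by
    rw [card_univ]
    have h1 : (k : ℝ) * Nat.clog 2 k ≤ k * (4 * Real.log k) :=
      mul_le_mul_of_nonneg_left hj (by linarith)
    have : ((N + 31 * k * Nat.clog 2 k : ℕ) : ℝ) ≤ Fintype.card V := by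
      push_cast
      linarith
    exact_mod_cast this
  have hfinish : ∀ {g : V → V → ℝ}, IsSignMatrix g → ∀ {S : Finset V}, k ≤ #S →
      (∀ v ∈ S, lam ≤ ∑ u ∈ S, g v u) → ∃ T : Finset V, #T = k ∧ ∀ v ∈ T, 0 ≤ ∑ u ∈ T, g v u := by
    intro g hg S hS hdeg
    rcases hg.exists_card_lt_two_mul hS hdeg with ⟨T, -, h⟩ | ⟨T, -, h1, h2, h3⟩
    · exact ⟨T, h⟩
    · obtain ⟨U, -, h⟩ := hg.exists_card_eq_of_le_degree hk h1 h2 h3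
      exact ⟨U, h⟩
  obtain ⟨S, -, hS, h | h⟩ := hf.exists_large_le_degree hlam1 hk
    (by rw [mul_pow, hlamsq]; linarith) hkN (Nat.le_pow_clog (by norm_num) k) hA
  · obtain ⟨T, hT, h⟩ := hfinish hf hS h
    exact ⟨T, hT, Or.inl h⟩
  · obtain ⟨T, hT, h⟩ := hfinish hf.neg hS h
    exact ⟨T, hT, Or.inr h⟩

end ExactSize

/-! ### Translation to graphs -/

section Graph

variable {V : Type u}

open Classical in
/-- The matrix with entry `1` at adjacent pairs and `-1` at distinct nonadjacent pairs. -/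
noncomputable def SimpleGraph.signMatrix (G : SimpleGraph V) (u v : V) : ℝ :=
  if u = v then 0 else if G.Adj u v then 1 else -1

theorem SimpleGraph.isSignMatrix_signMatrix (G : SimpleGraph V) : IsSignMatrix G.signMatrix where
  symm u v := by
    by_cases h : u = v
    · rw [h]
    · by_cases h' : G.Adj u v
      · simp [signMatrix, h, Ne.symm h, h', h'.symm]
      · simp [signMatrix, h, Ne.symm h, h', mt SimpleGraph.Adj.symm h']
  diag u := by simp [signMatrix]
  off_diag u v h := by
    simp only [signMatrix, h, if_false]
    split_ifs <;> simp

theorem SimpleGraph.signMatrix_compl (G : SimpleGraph V) (u v : V) :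
    Gᶜ.signMatrix u v = -G.signMatrix u v := by
  by_cases h : u = v <;> by_cases h' : G.Adj u v <;> simp [signMatrix, h, h']

open Classical in
theorem SimpleGraph.sum_signMatrix (G : SimpleGraph V) {S : Finset V} {v : V} (hv : v ∈ S) :
    ∑ u ∈ S, G.signMatrix v u = 2 * #{u ∈ S | G.Adj v u} - (#S - 1) := by
  have h : ∀ u, G.signMatrix v u =
      2 * (if G.Adj v u then 1 else 0) - (1 - if v = u then 1 else 0) := by
    intro u
    by_cases h : v = u
    · subst h
      simp [signMatrix]
    · by_cases h' : G.Adj v u <;> simp [signMatrix, h, h']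
      norm_num
  simp only [h, sum_sub_distrib, ← mul_sum, sum_boole]
  simp [filter_eq, hv]

theorem HasInducedMinDegree.of_sum_signMatrix_nonneg {G : SimpleGraph V} {k : ℕ} (hk : k ≠ 0)
    {S : Finset V} (hS : #S = k) (h : ∀ v ∈ S, 0 ≤ ∑ u ∈ S, G.signMatrix v u) :
    HasInducedMinDegree G k (((k : ℝ) - 1) / 2) := by
  classical
  refine ⟨S, hS, ?_⟩
  have hne : S.Nonempty := card_pos.1 (by lia)
  have : Nonempty (S : Set V) := hne.to_subtype
  obtain ⟨⟨v, hv⟩, hmin⟩ := (G.induce (S : Set V)).exists_minimal_degree_vertex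
  rw [hmin]
  have hdeg : (G.induce (S : Set V)).degree ⟨v, hv⟩ = #{u ∈ S | G.Adj v u} := by
    rw [← SimpleGraph.card_neighborFinset_eq_degree]
    refine card_bij (fun x _ => (x : V)) ?_ ?_ ?_
    · rintro ⟨x, hx⟩ hxm
      simpa using ⟨hx, by simpa using hxm⟩
    · rintro ⟨x, hx⟩ _ ⟨y, hy⟩ _ hxy
      exact Subtype.ext hxy
    · intro u hu
      obtain ⟨h1, h2⟩ := mem_filter.1 hu
      exact ⟨⟨u, h1⟩, by simpa using h2, rfl⟩
  have h1 := h v hv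
  rw [G.sum_signMatrix hv, hS] at h1
  have h2 : ((G.induce (S : Set V)).degree ⟨v, hv⟩ : ℝ) = #{u ∈ S | G.Adj v u} := by
    exact_mod_cast hdeg
  have goal : ((k : ℝ) - 1) / 2 ≤ (G.induce (S : Set V)).degree ⟨v, hv⟩ := by
    rw [h2]
    linarith
  convert goal

theorem hasInducedMinDegree_or_compl [Fintype V] (G : SimpleGraph V) {k : ℕ} (hk : 2 ≤ k)
    (hV : 2 ^ 28 * (k : ℝ) * Real.log k ≤ Fintype.card V) :
    HasInducedMinDegree G k (((k : ℝ) - 1) / 2) ∨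
      HasInducedMinDegree Gᶜ k (((k : ℝ) - 1) / 2) := by
  obtain ⟨S, hS, h | h⟩ := G.isSignMatrix_signMatrix.exists_card_eq_nonneg_degree hk hV
  · exact Or.inl (.of_sum_signMatrix_nonneg (by lia) hS h)
  · refine Or.inr (.of_sum_signMatrix_nonneg (by lia) hS ?_)
    simpa only [SimpleGraph.signMatrix_compl] using h

end Graph

theorem theorem1 :
    ∃ C : ℝ, 0 < C ∧ ∀ k : ℕ, 2 ≤ k →
      (∀ (V : Type u) [Fintype V] (G : SimpleGraph V),
        C * (k : ℝ) * Real.log (k : ℝ) ≤ (Fintype.card V : ℝ) →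
          HasInducedMinDegree G k (((k : ℝ) - 1) / 2) ∨
          HasInducedMinDegree Gᶜ k (((k : ℝ) - 1) / 2)) ∧
      (∃ R : ℕ, IsFixedQuasiRamseyNumber.{u} (1 / 2) k R ∧
        (R : ℝ) ≤ C * (k : ℝ) * Real.log (k : ℝ)) := by
  -- Doubling 2²⁸ absorbs the rounding up to an integer bound, since k log k ≥ 1.
  refine ⟨2 ^ 29, by norm_num, fun k hk => ?_⟩
  have hk2 : (2 : ℝ) ≤ k := by exact_mod_cast hk
  have hL : 1 / 2 ≤ Real.log k := by
    linarith [Real.log_two_gt_d9, Real.log_le_log (by norm_num) hk2]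
  have hkL : 1 ≤ (k : ℝ) * Real.log k := by nlinarith
  refine ⟨fun V _ G hV => hasInducedMinDegree_or_compl G hk (by linarith), ?_⟩
  set n := ⌈2 ^ 28 * (k : ℝ) * Real.log k⌉₊ with hn
  have hmem : n ∈ quasiRamseyBounds.{u} (1 / 2) k := by
    intro V _ G hV
    rw [one_div_mul_eq_div]
    exact hasInducedMinDegree_or_compl G hk ((Nat.le_ceil _).trans (Nat.cast_le.2 hV))
  refine ⟨sInf (quasiRamseyBounds.{u} (1 / 2) k),
    ⟨Nat.sInf_mem ⟨n, hmem⟩, fun m hm => Nat.sInf_le hm⟩, ?_⟩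
  have h1 : ((sInf (quasiRamseyBounds.{u} (1 / 2) k) : ℕ) : ℝ) ≤ n := by
    exact_mod_cast Nat.sInf_le hmem
  have h2 : (n : ℝ) < 2 ^ 28 * (k : ℝ) * Real.log k + 1 := Nat.ceil_lt_add_one (by linarith)
  linarith
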